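/- Let $G$ be a finite simple graph on $n$ vertices without isolated vertices, and let $\Phi=(G,\varphi)$ be a $\mathbb{T}$-gain graph on $G$: each oriented edge $\overrightarrow{e_{ij}}$ of $G$ carries a complex number $\varphi(\overrightarrow{e_{ij}})$ of modulus $1$, with $\varphi(\overrightarrow{e_{ji}})=\varphi(\overrightarrow{e_{ij}})^{-1}$. Write $d_v=d_\Phi(v)$ for the degree of $v$ in $G$. The gain normalized Laplacian $\mathcal{L}(\Phi)\in\mathbb{C}^{n\times n}$ has entries $\mathcal{L}_{ii}=1$ (if $d_i\neq 0$), $\mathcal{L}_{ij}=-\varphi(\overrightarrow{e_{ij}})/\sqrt{d_id_j}$ if $i$ and $j$ are adjacent, and $0$ otherwise. Let $$\Gamma(x,\mathcal{L}(\Phi))=\det(xI-\mathcal{L}(\Phi))=x^n+b_1x^{n-1}+\cdots+b_n.$$ Then for every $k=1,2,\dots,n$, $$(-1)^k b_k=\sum_{H}(-1)^{r(H)+o(H)}\,\frac{2^{s(H)}}{D_H}\prod_{C\in\mathcal{C}(H)}\operatorname{Re}(\varphi(C)),$$ where the sum runs over all dissection subgraphs $H$ of $G$ with exactly $k$ vertices,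 that is, subgraphs each of whose connected components is a single vertex, a single edge, or a cycle of length at least $3$. Here $r(H)=|V(H)|-p(H)$ and $s(H)=|E(H)|-|V(H)|+p(H)$, with $p(H)$ the number of connected components of $H$; $\mathcal{C}(H)$ is the set of cycles of $H$; $o(H)$ is the number of cycles of odd length in $\mathcal{C}(H)$; $\varphi(C)$ is the product of the gains of the oriented edges met when $C$ is traversed once (its real part does not depend on the starting point or the orientation); and $D_H=\prod_{v\in V(H),\,d_H(v)\neq 0}d_\Phi(v)$, where $d_H(v)$ is the degree of $v$ in $H$. -/

import Mathlib

noncomputable section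

namespace SimpleGraph

/-- A `𝕋`-gain graph with underlying graph `G`: every oriented edge (dart) carries a unit complex
number, and reversing the orientation inverts it. -/
structure GainGraph {V : Type*} (G : SimpleGraph V) where
  gain : G.Dart → Circle
  gain_symm : ∀ e : G.Dart, gain e.symm = (gain e)⁻¹

namespace GainGraph

/-- The gain normalized Laplacian: `1` on the diagonal at vertices of nonzero degree,
`-φ(e_{ij}) / √(d_i d_j)` if `i` and `j` are adjacent, and `0` otherwise. -/
def normalizedLaplacian {V : Type*} [Fintype V] [DecidableEq V] {G : SimpleGraph V}
    [DecidableRel G.Adj] (Φ : G.GainGraph) : Matrix V V ℂ :=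
  Matrix.of fun i j =>
    if i = j ∧ G.degree i ≠ 0 then 1
    else if h : G.Adj i j then
      -((Φ.gain ⟨(i, j), h⟩ : Circle) : ℂ) / (Real.sqrt ((G.degree i : ℝ) * (G.degree j : ℝ)) : ℂ)
    else 0

/-- The gain of a walk: the product of the gains of its oriented edges. -/
def walkGain {V : Type*} {G : SimpleGraph V} (Φ : G.GainGraph) {u v : V} (p : G.Walk u v) :
    Circle :=
  (p.darts.map Φ.gain).prod

end GainGraph

/-- A subgraph is a cycle if it is traversed by a closed walk which is a cycle
(in particular it has at least three vertices). -/
def Subgraph.IsCycleSubgraph {V : Type*} {G : SimpleGraph V} (C : G.Subgraph) : Prop :=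
  ∃ (u : V) (p : G.Walk u u), p.IsCycle ∧ p.toSubgraph = C

open Classical in
/-- The real part `Re φ(C)` of the gain of a cycle `C`, computed along some traversal of `C`.
It does not depend on the traversal, see `GainGraph.cycleGainRe_toSubgraph`. -/
def GainGraph.cycleGainRe {V : Type*} {G : SimpleGraph V} (Φ : G.GainGraph) (C : G.Subgraph) : ℝ :=
  if h : C.IsCycleSubgraph then ((Φ.walkGain h.choose_spec.choose : Circle) : ℂ).re else 0

theorem Walk.IsCycle.length_eq_ncard_edgeSet {V : Type*} {G : SimpleGraph V} {u : V}
    {p : G.Walk u u} (hp : p.IsCycle) : p.length = p.toSubgraph.edgeSet.ncard := by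
  classical
  have h : p.toSubgraph.edgeSet = (p.edges.toFinset : Set (Sym2 V)) := by
    ext e
    simp
  rw [h, Set.ncard_coe_finset, List.toFinset_card_of_nodup hp.edges_nodup, Walk.length_edges]

theorem Walk.IsCycle.eq_of_snd_eq {V : Type*} {G : SimpleGraph V} {u : V}
    {p q : G.Walk u u} (hp : p.IsCycle) (hq : q.IsCycle) (h : p.toSubgraph = q.toSubgraph)
    (hs : p.snd = q.snd) : p = q := by
  have hl : p.length = q.length := by
    rw [hp.length_eq_ncard_edgeSet, hq.length_eq_ncard_edgeSet, h]
  have key : ∀ i, i < p.length → p.getVert i = q.getVert i ∧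
      p.getVert (i + 1) = q.getVert (i + 1) := by
    intro i
    induction i with
    | zero => exact fun _ => ⟨by simp, hs⟩
    | succ i ih =>
      intro hi
      obtain ⟨h1, h2⟩ := ih (by lia)
      refine ⟨h2, ?_⟩
      have e1 := hp.neighborSet_toSubgraph_internal (i := i + 1) (by lia) hi
      have e2 := hq.neighborSet_toSubgraph_internal (i := i + 1) (by lia) (by lia)
      have n1 := hp.getVert_sub_one_ne_getVert_add_one (i := i + 1) (by lia)
      have n2 := hq.getVert_sub_one_ne_getVert_add_one (i := i + 1) (by lia)
      rw [h, h2, e2] at e1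
      simp only [Nat.add_sub_cancel] at e1 n1 n2
      rw [h1] at e1 n1
      have hm : p.getVert (i + 1 + 1) ∈ ({q.getVert i, q.getVert (i + 1 + 1)} : Set V) := by
        rw [e1]; simp
      rcases hm with hm | hm
      · exact absurd hm.symm n1
      · exact hm
  refine Walk.ext_getVert_le_length hl fun i hi => ?_
  rcases Nat.lt_or_ge i p.length with h' | h'
  · exact (key i h').1
  · have : i = p.length := le_antisymm hi h'
    rw [this, Walk.getVert_length, hl, Walk.getVert_length]

theorem GainGraph.walkGain_reverse {V : Type*} {G : SimpleGraph V} (Φ : G.GainGraph) {u v : V}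
    (p : G.Walk u v) : Φ.walkGain p.reverse = (Φ.walkGain p)⁻¹ := by
  have h : (Φ.gain ∘ Dart.symm) = (fun e => (Φ.gain e)⁻¹) := by
    funext e
    exact Φ.gain_symm e
  simp only [GainGraph.walkGain, Walk.darts_reverse, List.map_reverse, List.prod_reverse,
    List.map_map, h]
  rw [List.prod_inv, List.map_map]
  rfl

/-- The real part of the gain of a cycle is independent of starting point and orientation. -/
theorem GainGraph.walkGain_re_eq {V : Type*} {G : SimpleGraph V} (Φ : G.GainGraph) {u v : V}
    {p : G.Walk u u} {q : G.Walk v v} (hp : p.IsCycle) (hq : q.IsCycle)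
    (h : p.toSubgraph = q.toSubgraph) :
    ((Φ.walkGain p : Circle) : ℂ).re = ((Φ.walkGain q : Circle) : ℂ).re := by
  classical
  have hu : u ∈ q.support := by
    rw [← Walk.mem_verts_toSubgraph, ← h]
    simp
  have hr : Φ.walkGain (q.rotate u hu) = Φ.walkGain q :=
    (((q.rotate_darts u hu).perm).map Φ.gain).prod_eq
  have hr' : (q.rotate u hu).IsCycle := hq.rotate hu
  have hs : p.toSubgraph = (q.rotate u hu).toSubgraph := by rw [h, Walk.toSubgraph_rotate]
  rw [← hr]
  generalize q.rotate u hu = q' at hr' hs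
  have hn := hp.neighborSet_toSubgraph_endpoint
  rw [hs, hr'.neighborSet_toSubgraph_endpoint] at hn
  have hm : p.snd ∈ ({q'.snd, q'.penultimate} : Set V) := by
    rw [hn]; simp
  rcases hm with hm | hm
  · rw [hp.eq_of_snd_eq hr' hs hm]
  · have : p = q'.reverse :=
      hp.eq_of_snd_eq hr'.reverse (by rw [Walk.toSubgraph_reverse, hs]) (by simpa using hm)
    rw [this, Φ.walkGain_reverse, Circle.coe_inv_eq_conj, Complex.conj_re]

theorem GainGraph.cycleGainRe_toSubgraph {V : Type*} {G : SimpleGraph V} (Φ : G.GainGraph) {u : V}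
    {p : G.Walk u u} (hp : p.IsCycle) :
    Φ.cycleGainRe p.toSubgraph = ((Φ.walkGain p : Circle) : ℂ).re := by
  have h : p.toSubgraph.IsCycleSubgraph := ⟨u, p, hp, rfl⟩
  rw [GainGraph.cycleGainRe, dif_pos h]
  exact Φ.walkGain_re_eq h.choose_spec.choose_spec.1 hp h.choose_spec.choose_spec.2

namespace Subgraph

/-- A dissection subgraph: every connected component is a single vertex, a single edge or
a cycle (of length at least three). -/
def IsDissection {V : Type*} {G : SimpleGraph V} (H : G.Subgraph) : Prop :=
  ∀ c : H.coe.ConnectedComponent,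
    Nonempty (c.toSimpleGraph ≃g completeGraph (Fin 1)) ∨
    Nonempty (c.toSimpleGraph ≃g completeGraph (Fin 2)) ∨
    ∃ m : ℕ, 3 ≤ m ∧ Nonempty (c.toSimpleGraph ≃g cycleGraph m)

/-- The rank `r(H)`: number of vertices minus number of connected components. -/
def rank {V : Type*} {G : SimpleGraph V} (H : G.Subgraph) : ℤ :=
  (H.verts.ncard : ℤ) - (Nat.card H.coe.ConnectedComponent : ℤ)

/-- The corank `s(H)`: number of edges minus number of vertices plus number of components. -/
def corank {V : Type*} {G : SimpleGraph V} (H : G.Subgraph) : ℤ :=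
  (H.edgeSet.ncard : ℤ) - (H.verts.ncard : ℤ) + (Nat.card H.coe.ConnectedComponent : ℤ)

open Classical in
/-- The set `𝒞(H)` of cycles contained in `H`. -/
def cycles {V : Type*} [Fintype V] {G : SimpleGraph V} (H : G.Subgraph) : Finset G.Subgraph :=
  {C : G.Subgraph | C ≤ H ∧ C.IsCycleSubgraph}

open Classical in
/-- The number `o(H)` of odd cycles in `H`. -/
def oddCycles {V : Type*} [Fintype V] {G : SimpleGraph V} (H : G.Subgraph) : ℕ :=
  (H.cycles.filter fun C => Odd C.verts.ncard).card

open Classical in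
/-- The product `D_H` of the degrees in `G` of the vertices of `H` that are not isolated in `H`. -/
def degreeProd {V : Type*} [Fintype V] {G : SimpleGraph V} (H : G.Subgraph) : ℕ :=
  ∏ v : V with v ∈ H.verts ∧ H.degree v ≠ 0, G.degree v

open Classical in
/-- The set of dissection subgraphs of `G` with exactly `k` vertices. -/
def dissections {V : Type*} [Fintype V] (G : SimpleGraph V) (k : ℕ) : Finset G.Subgraph :=
  {H : G.Subgraph | H.IsDissection ∧ H.verts.ncard = k}

end Subgraph

end SimpleGraph

end

open Finset in
/-- The coefficients of the characteristic polynomial as signed sums over pairs of a permutation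
and a set of prescribed size containing its support. -/
theorem Matrix.neg_one_pow_mul_charpoly_coeff {V R : Type*} [Fintype V] [DecidableEq V]
    [CommRing R] (M : Matrix V V R) {k : ℕ} (hk : k ≤ Fintype.card V) :
    (-1) ^ k * M.charpoly.coeff (Fintype.card V - k) =
      ∑ σ : Equiv.Perm V, ∑ S ∈ powersetCard k univ with σ.support ⊆ S,
        ((σ.sign : ℤ) : R) * ∏ i ∈ S, M i (σ i) := by
  rw [← Matrix.charpoly_transpose, Matrix.charpoly, Matrix.det_apply', Polynomial.finsetSum_coeff,
    mul_sum]
  refine sum_congr rfl fun σ _ => ?_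
  have h1 : ∏ i, M.transpose.charmatrix (σ i) i =
      ∑ t ∈ (univ : Finset V).powerset, (if σ.support ⊆ t then
        (Polynomial.X : Polynomial R) ^ (Fintype.card V - #t) else 0) *
          Polynomial.C ((-1) ^ #t * ∏ i ∈ t, M i (σ i)) := by
    have : ∀ i, M.transpose.charmatrix (σ i) i =
        Polynomial.C (-M i (σ i)) + (if σ i = i then Polynomial.X else 0) := by
      intro i
      rw [Matrix.charmatrix_apply, Matrix.diagonal_apply, Matrix.transpose_apply, map_neg]
      ring
    simp_rw [this]
    rw [prod_add]
    refine sum_congr rfl fun t _ => ?_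
    rw [mul_comm, ← map_prod, prod_neg]
    congr 1
    split_ifs with h
    · rw [prod_congr rfl (g := fun _ => (Polynomial.X : Polynomial R)), prod_const,
        card_sdiff_of_subset (subset_univ _), card_univ]
      intro i hi
      have : i ∉ σ.support := fun h' => (mem_sdiff.1 hi).2 (h h')
      rw [if_pos (by simpa using this)]
    · obtain ⟨i, hi, hit⟩ := not_subset.1 h
      exact prod_eq_zero (i := i) (by simpa using hit) (if_neg (by simpa using hi))
  have h2 : (((σ.sign : ℤ) : Polynomial R)) = Polynomial.C ((σ.sign : ℤ) : R) := by simp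
  rw [h1, h2, Polynomial.coeff_C_mul, Polynomial.finsetSum_coeff, mul_sum, mul_sum, sum_filter,
    ← sum_filter_add_sum_filter_not _ (fun t : Finset V => #t = k)]
  rw [sum_eq_zero (s := filter (fun t : Finset V => ¬ #t = k) _), add_zero]
  · refine sum_congr (by ext; simp) fun t ht => ?_
    rw [(mem_powersetCard.1 ht).2, Polynomial.coeff_mul_C]
    split_ifs
    · rw [Polynomial.coeff_X_pow, if_pos rfl]
      have : ((-1 : R) ^ k) * (-1) ^ k = 1 := by rw [← mul_pow]; simp
      linear_combination (((σ.sign : ℤ) : R) * ∏ i ∈ t, M i (σ i)) * this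
    · simp
  · intro t ht
    have ht' := (mem_filter.1 ht).2
    have htc : #t ≤ Fintype.card V := card_le_univ t
    rw [Polynomial.coeff_mul_C]
    split_ifs
    · rw [Polynomial.coeff_X_pow, if_neg (by omega)]
      simp
    · simp

namespace Equiv.Perm

variable {V : Type*} [Fintype V] [DecidableEq V]

open _root_.Finset

@[to_additive]
theorem prod_support_eq_prod_cycleFactorsFinset {M : Type*} [CommMonoid M] (σ : Perm V)
    (f : V → M) :
    ∏ v ∈ σ.support, f v = ∏ c ∈ σ.cycleFactorsFinset, ∏ v ∈ c.support, f v := by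
  rw [← prod_fiberwise_of_maps_to (s := σ.support) (t := σ.cycleFactorsFinset) (g := σ.cycleOf)
    (fun v hv => cycleOf_mem_cycleFactorsFinset_iff.2 hv)]
  refine prod_congr rfl fun c hc => prod_congr ?_ fun _ _ => rfl
  ext v
  rw [mem_filter, ← eq_cycleOf_of_mem_cycleFactorsFinset_iff σ c hc v]
  constructor
  · exact fun h => h.2.symm
  · intro h
    refine ⟨?_, h.symm⟩
    rw [← cycleOf_mem_cycleFactorsFinset_iff, ← h]
    exact hc

theorem card_support_eq_sum_cycleFactorsFinset (σ : Perm V) :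
    #σ.support = ∑ c ∈ σ.cycleFactorsFinset, #c.support := by
  have := sum_support_eq_sum_cycleFactorsFinset σ (fun _ => 1)
  simpa using this

theorem sign_eq_neg_one_pow (σ : Perm V) :
    (σ.sign : ℤ) = (-1) ^ (#σ.support + #σ.cycleFactorsFinset) := by
  rw [sign_of_cycleType, sum_cycleType]
  simp [cycleType_def]

theorem two_le_card_support_of_mem_cycleFactorsFinset {σ c : Perm V}
    (hc : c ∈ σ.cycleFactorsFinset) : 2 ≤ #c.support :=
  (mem_cycleFactorsFinset_iff.1 hc).1.two_le_card_support

theorem apply_apply_eq_self_iff_card_support {σ c : Perm V} (hc : c ∈ σ.cycleFactorsFinset) {v : V}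
    (hv : v ∈ c.support) : σ (σ v) = v ↔ #c.support = 2 := by
  have h := (isCycleOn_support_of_mem_cycleFactorsFinset hc).pow_apply_eq hv (n := 2)
  have h2 := two_le_card_support_of_mem_cycleFactorsFinset hc
  rw [pow_two, mul_apply] at h
  rw [h]
  exact ⟨fun h => le_antisymm (Nat.le_of_dvd (by norm_num) h) h2, fun h => by rw [h]⟩

theorem apply_mem_support_of_mem_cycleFactorsFinset {σ c : Perm V} (hc : c ∈ σ.cycleFactorsFinset)
    {v : V} : σ v ∈ c.support ↔ v ∈ c.support :=
  (isCycleOn_support_of_mem_cycleFactorsFinset hc).apply_mem_iff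

theorem prod_support_apply {M : Type*} [CommMonoid M] (σ : Perm V) (f : V → M) :
    ∏ v ∈ σ.support, f (σ v) = ∏ v ∈ σ.support, f v :=
  prod_equiv σ (fun v => by simp) fun _ _ => rfl

/-- The cycles of length at least three of a permutation. -/
def longCycles (σ : Perm V) : Finset (Perm V) := σ.cycleFactorsFinset.filter (2 < #·.support)

theorem mem_longCycles {σ c : Perm V} :
    c ∈ σ.longCycles ↔ c ∈ σ.cycleFactorsFinset ∧ 2 < #c.support := mem_filter

theorem eq_cycleOf_iff_mem_support {σ c : Perm V} (hc : c ∈ σ.cycleFactorsFinset) {v : V} :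
    σ.cycleOf v = c ↔ v ∈ c.support := by
  rw [← eq_cycleOf_of_mem_cycleFactorsFinset_iff σ c hc v, eq_comm]

omit [DecidableEq V] in
theorem SameCycle.closed_of_apply {σ : Perm V} {p : V → Prop} (hp : ∀ v, p v → p (σ v)) {v w : V}
    (h : σ.SameCycle v w) (hv : p v) : p w := by
  obtain ⟨n, -, rfl⟩ := h.exists_pow_eq'
  clear h
  induction n with
  | zero => simpa
  | succ n ih =>
    rw [pow_succ', mul_apply]
    exact hp _ ih

theorem SameCycle.iff_sum_cycleOf (σ : Perm V) (v w : V) :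
    (if σ v = v then (Sum.inl v : V ⊕ Perm V) else Sum.inr (σ.cycleOf v)) =
      (if σ w = w then Sum.inl w else Sum.inr (σ.cycleOf w)) ↔ σ.SameCycle v w := by
  split_ifs with hv hw hw
  · rw [Sum.inl.injEq]
    exact ⟨fun h => h ▸ SameCycle.refl σ v, fun h => SameCycle.closed_of_apply (p := (v = ·))
      (fun x hx => by subst hx; exact hv.symm) h (Eq.refl v)⟩
  · simp only [false_iff]
    exact fun h => hw (h.apply_eq_self_iff.1 hv)
  · simp only [false_iff]
    exact fun h => hv (h.apply_eq_self_iff.2 hw)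
  · rw [Sum.inr.injEq, sameCycle_iff_cycleOf_eq_of_mem_support (mem_support.2 hv)
      (mem_support.2 hw)]

end Equiv.Perm

namespace SimpleGraph

open Finset Equiv.Perm

namespace Subgraph

variable {V : Type*} {G : SimpleGraph V}

theorem mem_cycles [Fintype V] {H C : G.Subgraph} :
    C ∈ H.cycles ↔ C ≤ H ∧ C.IsCycleSubgraph := by
  simp [cycles]

/-- `σ` traverses `H` if the edges of `H` join each vertex not fixed by `σ` to its image. -/
def TraversedBy (H : G.Subgraph) (σ : Equiv.Perm V) : Prop :=
  ∀ v w, H.Adj v w ↔ v ≠ w ∧ (σ v = w ∨ σ w = v)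

namespace TraversedBy

variable {H : G.Subgraph} {σ : Equiv.Perm V}

theorem adj_apply (h : H.TraversedBy σ) {v : V} (hv : σ v ≠ v) : H.Adj v (σ v) :=
  (h _ _).2 ⟨hv.symm, Or.inl rfl⟩

theorem apply_mem_verts (h : H.TraversedBy σ) {v : V} (hv : v ∈ H.verts) : σ v ∈ H.verts := by
  by_cases hs : σ v = v
  · rwa [hs]
  · exact (h.adj_apply hs).snd_mem

theorem sameCycle_of_adj (h : H.TraversedBy σ) {v w : V} (hvw : H.Adj v w) : σ.SameCycle v w := by
  rcases ((h _ _).1 hvw).2 with rfl | rfl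
  · exact sameCycle_apply_right.2 (SameCycle.refl σ v)
  · exact sameCycle_apply_left.2 (SameCycle.refl σ w)

theorem neighborSet_eq (h : H.TraversedBy σ) (v : V) :
    H.neighborSet v = {w | v ≠ w ∧ (w = σ v ∨ w = σ⁻¹ v)} := by
  ext w
  rw [mem_neighborSet, h, Set.mem_ofPred_eq, eq_comm (a := σ v), eq_comm (a := w) (b := σ⁻¹ v),
    inv_eq_iff_eq, eq_comm (a := v) (b := σ w)]

variable [Fintype V] [DecidableEq V]

theorem reachable_iff (h : H.TraversedBy σ) (v w : H.verts) :
    H.coe.Reachable v w ↔ σ.SameCycle v w := by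
  constructor
  · rintro ⟨p⟩
    induction p with
    | nil => exact SameCycle.refl _ _
    | cons ha _ ih => exact (h.sameCycle_of_adj ha).trans ih
  · intro hs
    have := hs.closed_of_apply (p := fun x => ∃ hx : x ∈ H.verts, H.coe.Reachable v ⟨x, hx⟩) ?_
      ⟨v.2, Reachable.refl _⟩
    · exact this.2
    · rintro x ⟨hx, hr⟩
      by_cases hs : σ x = x
      · rw [hs]; exact ⟨hx, hr⟩
      · exact ⟨h.apply_mem_verts hx, hr.trans (Adj.reachable (h.adj_apply hs))⟩

theorem support_subset (h : H.TraversedBy σ) : (σ.support : Set V) ⊆ H.verts :=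
  fun _ hv => (h.adj_apply (Equiv.Perm.mem_support.1 hv)).fst_mem

theorem card_connectedComponent (h : H.TraversedBy σ) :
    Nat.card H.coe.ConnectedComponent + #σ.support = H.verts.ncard + #σ.cycleFactorsFinset := by
  classical
  set g : V → V ⊕ Equiv.Perm V := fun v => if σ v = v then Sum.inl v else Sum.inr (σ.cycleOf v)
    with hg
  let f : H.coe.ConnectedComponent → V ⊕ Equiv.Perm V :=
    Quot.lift (fun v => g v) fun v w hvw =>
      (SameCycle.iff_sum_cycleOf σ v w).2 ((h.reachable_iff v w).1 hvw)
  have hf : Function.Injective f := by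
    rintro ⟨v⟩ ⟨w⟩ hvw
    exact Quot.sound ((h.reachable_iff v w).2 ((SameCycle.iff_sum_cycleOf σ v w).1 hvw))
  have hr : Set.range f =
      ((H.verts.toFinset \ σ.support).disjSum σ.cycleFactorsFinset : Finset (V ⊕ Equiv.Perm V)) := by
    ext x
    rw [mem_coe, mem_disjSum]
    constructor
    · rintro ⟨⟨v⟩, rfl⟩
      by_cases hv : σ v = v
      · exact Or.inl ⟨v, by simp [hv], by simp [f, g, hv]⟩
      · exact Or.inr ⟨σ.cycleOf v, cycleOf_mem_cycleFactorsFinset_iff.2 (Equiv.Perm.mem_support.2 hv),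
          by simp [f, g, hv]⟩
    · rintro (⟨v, hv, rfl⟩ | ⟨c, hc, rfl⟩)
      · have hv' := mem_sdiff.1 hv
        have hf : σ v = v := by simpa using hv'.2
        exact ⟨Quot.mk _ ⟨v, by simpa using hv'.1⟩, by simp [f, g, hf]⟩
      · obtain ⟨v, hv⟩ := (mem_cycleFactorsFinset_iff.1 hc).1.nonempty_support
        have hvs := mem_cycleFactorsFinset_support_le hc hv
        refine ⟨Quot.mk _ ⟨v, h.support_subset hvs⟩, ?_⟩
        have hf := Equiv.Perm.mem_support.1 hvs
        simp [f, g, hf, (eq_cycleOf_iff_mem_support hc).2 hv]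
  rw [← Nat.card_range_of_injective hf, hr, Nat.card_coe_set_eq, Set.ncard_coe_finset,
    card_disjSum, card_sdiff_of_subset (by rw [← coe_subset]; simpa using h.support_subset),
    ← Set.ncard_eq_toFinset_card']
  have : #σ.support ≤ H.verts.ncard := by
    rw [← Set.ncard_coe_finset]; exact Set.ncard_le_ncard h.support_subset
  omega

open Classical in
theorem degree_eq (h : H.TraversedBy σ) (v : V) :
    H.degree v = if σ v = v then 0 else if σ (σ v) = v then 1 else 2 := by
  rw [← finset_card_neighborSet_eq_degree, ← Set.ncard_eq_toFinset_card',
    h.neighborSet_eq]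
  split_ifs with h1 h2
  · rw [Set.ncard_eq_zero]
    ext w
    have : σ⁻¹ v = v := by rw [inv_eq_iff_eq, h1]
    simp only [h1, this, Set.mem_ofPred_eq, Set.mem_empty_iff_false]
    tauto
  · rw [Set.ncard_eq_one]
    have : σ⁻¹ v = σ v := by rw [inv_eq_iff_eq, h2]
    refine ⟨σ v, ?_⟩
    ext w
    simp only [this, Set.mem_ofPred_eq, Set.mem_singleton_iff]
    grind
  · rw [Set.ncard_eq_two]
    have hne : σ v ≠ σ⁻¹ v := by
      intro h'; exact h2 (by rw [h']; simp)
    have hi : σ⁻¹ v ≠ v := fun h' => h1 (inv_eq_iff_eq.1 h').symm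
    refine ⟨σ v, σ⁻¹ v, hne, ?_⟩
    ext w
    simp only [Set.mem_ofPred_eq, Set.mem_insert_iff, Set.mem_singleton_iff]
    grind

open Classical in
theorem degree_ne_zero_iff (h : H.TraversedBy σ) (v : V) : H.degree v ≠ 0 ↔ v ∈ σ.support := by
  rw [h.degree_eq, Equiv.Perm.mem_support]
  split_ifs <;> simp_all

theorem ncard_edgeSet (h : H.TraversedBy σ) :
    H.edgeSet.ncard = ∑ c ∈ σ.cycleFactorsFinset, if #c.support = 2 then 1 else #c.support := by
  classical
  have h1 := H.spanningCoe.sum_degrees_eq_twice_card_edges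
  rw [← Set.ncard_coe_finset, coe_edgeFinset, edgeSet_spanningCoe] at h1
  have h2 : ∑ v, H.spanningCoe.degree v =
      ∑ v ∈ σ.support, if σ (σ v) = v then 1 else 2 := by
    rw [← sum_subset (subset_univ σ.support)]
    · refine sum_congr rfl fun v hv => ?_
      rw [degree_spanningCoe, h.degree_eq, if_neg (Equiv.Perm.mem_support.1 hv)]
    · intro v _ hv
      rw [degree_spanningCoe, h.degree_eq, if_pos (by simpa using hv)]
  have h3 : ∑ c ∈ σ.cycleFactorsFinset, ∑ v ∈ c.support, (if σ (σ v) = v then 1 else 2) =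
      ∑ c ∈ σ.cycleFactorsFinset, 2 * if #c.support = 2 then 1 else #c.support := by
    refine sum_congr rfl fun c hc => ?_
    rw [sum_congr rfl (g := fun _ => if #c.support = 2 then 1 else 2)
      fun v hv => by simp only [apply_apply_eq_self_iff_card_support hc hv], sum_const]
    split_ifs with h <;> simp [h, mul_comm]
  rw [h2, sum_support_eq_sum_cycleFactorsFinset, h3, ← mul_sum] at h1
  omega

theorem corank_eq (h : H.TraversedBy σ) : H.corank = #σ.longCycles := by
  have h1 := h.card_connectedComponent
  have h2 := h.ncard_edgeSet
  have h3 := σ.card_support_eq_sum_cycleFactorsFinset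
  have h4 : ∑ c ∈ σ.cycleFactorsFinset, (if #c.support = 2 then 1 else #c.support) +
      #σ.cycleFactorsFinset = ∑ c ∈ σ.cycleFactorsFinset, #c.support + #σ.longCycles := by
    rw [card_eq_sum_ones, longCycles, card_filter, ← sum_add_distrib, ← sum_add_distrib]
    refine sum_congr rfl fun c hc => ?_
    have := two_le_card_support_of_mem_cycleFactorsFinset hc
    split_ifs <;> omega
  rw [corank]
  omega

theorem neg_one_zpow_rank (h : H.TraversedBy σ) : (-1 : ℝ) ^ H.rank = ((σ.sign : ℤ) : ℝ) := by
  have h1 := h.card_connectedComponent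
  rw [sign_eq_neg_one_pow, rank]
  have : (H.verts.ncard : ℤ) - Nat.card H.coe.ConnectedComponent =
    ((#σ.support + #σ.cycleFactorsFinset : ℕ) : ℤ) - 2 * (#σ.cycleFactorsFinset : ℤ) := by omega
  rw [this, zpow_sub₀ (by norm_num), zpow_natCast, zpow_mul]
  simp

open Classical in
theorem degreeProd_eq (h : H.TraversedBy σ) : H.degreeProd = ∏ v ∈ σ.support, G.degree v := by
  rw [degreeProd]
  refine prod_congr ?_ fun _ _ => rfl
  ext v
  simp only [mem_filter, mem_univ, true_and]
  rw [h.degree_ne_zero_iff]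
  exact ⟨fun h => h.2, fun hv => ⟨h.support_subset hv, hv⟩⟩

end TraversedBy

end Subgraph

end SimpleGraph

namespace SimpleGraph

open Finset Equiv.Perm

/-- The walk which follows a function `f : ℕ → V` with adjacent consecutive values. -/
def Walk.ofSeq {V : Type*} {G : SimpleGraph V} (f : ℕ → V) (h : ∀ n, G.Adj (f n) (f (n + 1))) :
    ∀ n, G.Walk (f 0) (f n)
  | 0 => Walk.nil
  | n + 1 => (Walk.ofSeq f h n).concat (h n)

section ofSeq

variable {V : Type*} {G : SimpleGraph V} {f : ℕ → V} (h : ∀ n, G.Adj (f n) (f (n + 1)))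

theorem Walk.support_ofSeq (n : ℕ) : (Walk.ofSeq f h n).support = (List.range (n + 1)).map f := by
  induction n with
  | zero => simp [ofSeq]
  | succ n ih => rw [ofSeq, support_concat, ih, List.range_succ (n := n + 1)]; simp

theorem Walk.edges_ofSeq (n : ℕ) :
    (Walk.ofSeq f h n).edges = (List.range n).map fun i => s(f i, f (i + 1)) := by
  induction n with
  | zero => simp [ofSeq]
  | succ n ih => rw [ofSeq, edges_concat, ih, List.range_succ]; simp

end ofSeq

namespace GainGraph

variable {V : Type*} {G : SimpleGraph V}

open Classical in
/-- The gain of the oriented edge from `v` to `w`, extended by `1` to nonadjacent pairs. -/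
noncomputable def pairGain (Φ : G.GainGraph) (v w : V) : ℂ :=
  if h : G.Adj v w then (Φ.gain ⟨(v, w), h⟩ : Circle) else 1

theorem pairGain_symm (Φ : G.GainGraph) (v w : V) : Φ.pairGain w v = (Φ.pairGain v w)⁻¹ := by
  rw [pairGain, pairGain]
  by_cases h : G.Adj v w
  · rw [dif_pos h, dif_pos h.symm, ← Circle.coe_inv, ← Φ.gain_symm]
    rfl
  · rw [dif_neg h, dif_neg fun h' => h h'.symm, inv_one]

theorem norm_pairGain (Φ : G.GainGraph) (v w : V) : ‖Φ.pairGain v w‖ = 1 := by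
  rw [pairGain]
  split_ifs
  · exact Circle.norm_coe _
  · exact norm_one

theorem coe_walkGain_cons (Φ : G.GainGraph) {u v w : V} (h : G.Adj u v) (p : G.Walk v w) :
    (Φ.walkGain (p.cons h) : ℂ) = Φ.pairGain u v * Φ.walkGain p := by
  simp [walkGain, pairGain, h]

theorem coe_walkGain_ofSeq (Φ : G.GainGraph) {f : ℕ → V} (h : ∀ n, G.Adj (f n) (f (n + 1)))
    (n : ℕ) : (Φ.walkGain (Walk.ofSeq f h n) : ℂ) =
      ∏ i ∈ range n, Φ.pairGain (f i) (f (i + 1)) := by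
  induction n with
  | zero => simp [walkGain, Walk.ofSeq]
  | succ n ih =>
    rw [prod_range_succ, ← ih]
    simp [walkGain, Walk.ofSeq, pairGain, h]

end GainGraph

theorem Walk.sameCycle_of_mem_support {V : Type*} {G : SimpleGraph V} {σ : Equiv.Perm V} {u v : V}
    (p : G.Walk u v) (hp : ∀ e ∈ p.darts, σ.SameCycle e.fst e.snd) {w : V} (hw : w ∈ p.support) :
    σ.SameCycle u w := by
  induction p with
  | nil =>
    obtain rfl : w = _ := by simpa using hw
    exact SameCycle.refl _ _
  | cons ha p ih =>
    rw [support_cons, List.mem_cons] at hw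
    rcases hw with rfl | hw
    · exact SameCycle.refl _ _
    · exact (hp ⟨(_, _), ha⟩ (by simp)).trans (ih (fun e he => hp e (by simp [he])) hw)

namespace Subgraph.TraversedBy

variable {V : Type*} {G : SimpleGraph V} {H : G.Subgraph} {σ : Equiv.Perm V}
  [Fintype V] [DecidableEq V]

omit [DecidableEq V] in
theorem neighborSet_of_isCycle (h : H.TraversedBy σ) {u : V} {p : G.Walk u u} (hp : p.IsCycle)
    (hpH : p.toSubgraph ≤ H) {v : V} (hv : v ∈ p.support) :
    p.toSubgraph.neighborSet v = {σ v, σ⁻¹ v} ∧ σ v ≠ σ⁻¹ v := by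
  have h2 := hp.ncard_neighborSet_toSubgraph_eq_two hv
  have hsub : p.toSubgraph.neighborSet v ⊆ {σ v, σ⁻¹ v} := by
    refine (Subgraph.neighborSet_subset_of_subgraph hpH v).trans ?_
    rw [h.neighborSet_eq]
    exact fun w hw => hw.2
  have heq := Set.eq_of_subset_of_ncard_le hsub (by
    rw [h2]
    exact (Set.ncard_insert_le _ _).trans (by rw [Set.ncard_singleton]))
  refine ⟨heq, fun hne => ?_⟩
  rw [heq, hne] at h2
  simp at h2

theorem toSubgraph_eq_induce (h : H.TraversedBy σ) {u : V} {p : G.Walk u u} (hp : p.IsCycle)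
    (hpH : p.toSubgraph ≤ H) :
    σ.cycleOf u ∈ σ.longCycles ∧ p.toSubgraph = H.induce ((σ.cycleOf u).support : Set V) := by
  obtain ⟨hn, hne⟩ := h.neighborSet_of_isCycle hp hpH p.start_mem_support
  have hu : u ∈ σ.support := by
    rw [Equiv.Perm.mem_support]
    intro hu
    exact hne (by rw [hu, eq_inv_iff_eq, hu])
  have hc : σ.cycleOf u ∈ σ.cycleFactorsFinset := cycleOf_mem_cycleFactorsFinset_iff.2 hu
  have huc : u ∈ (σ.cycleOf u).support := (eq_cycleOf_iff_mem_support hc).1 rfl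
  have h2 := two_le_card_support_of_mem_cycleFactorsFinset hc
  have h3 : #(σ.cycleOf u).support ≠ 2 := by
    rw [Ne, ← apply_apply_eq_self_iff_card_support hc huc]
    exact fun h' => hne (eq_inv_iff_eq.2 h')
  refine ⟨mem_longCycles.2 ⟨hc, by omega⟩, ?_⟩
  have hverts : ∀ w, w ∈ p.support ↔ w ∈ (σ.cycleOf u).support := by
    intro w
    rw [mem_support_cycleOf_iff' (Equiv.Perm.mem_support.1 hu)]
    constructor
    · refine p.sameCycle_of_mem_support fun e he => h.sameCycle_of_adj (hpH.2 ?_)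
      rw [Walk.adj_toSubgraph_iff_mem_edges]
      exact List.mem_map_of_mem (f := Dart.edge) he
    · refine fun hs => hs.closed_of_apply (p := (· ∈ p.support)) (fun v hv => ?_)
        p.start_mem_support
      have hm : σ v ∈ p.toSubgraph.neighborSet v := by
        rw [(h.neighborSet_of_isCycle hp hpH hv).1]; simp
      rw [← Walk.mem_verts_toSubgraph]
      exact Subgraph.Adj.snd_mem hm
  refine Subgraph.ext ?_ ?_
  · ext w
    rw [Walk.mem_verts_toSubgraph, hverts]
    rfl
  · ext v w
    rw [induce_adj, mem_coe, mem_coe, ← hverts, ← hverts]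
    constructor
    · exact fun ha => ⟨(Walk.mem_verts_toSubgraph _).1 ha.fst_mem,
        (Walk.mem_verts_toSubgraph _).1 ha.snd_mem, hpH.2 ha⟩
    · rintro ⟨hv, -, ha⟩
      rw [← mem_neighborSet, (h.neighborSet_of_isCycle hp hpH hv).1]
      have : w ∈ H.neighborSet v := ha
      rw [h.neighborSet_eq] at this
      exact this.2

theorem exists_isCycle (h : H.TraversedBy σ) {c : Equiv.Perm V} (hc : c ∈ σ.longCycles)
    (Φ : G.GainGraph) :
    ∃ (u : V) (p : G.Walk u u), p.IsCycle ∧ p.toSubgraph = H.induce (c.support : Set V) ∧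
      (Φ.walkGain p : ℂ) = ∏ v ∈ c.support, Φ.pairGain v (σ v) := by
  obtain ⟨hc, h3⟩ := mem_longCycles.1 hc
  obtain ⟨u, hu⟩ := (mem_cycleFactorsFinset_iff.1 hc).1.nonempty_support
  have hcyc := isCycleOn_support_of_mem_cycleFactorsFinset hc
  obtain ⟨m, hm⟩ : ∃ m, #c.support = m + 1 := ⟨#c.support - 1, by omega⟩
  have hmem : ∀ n, (σ ^ n) u ∈ c.support := by
    intro n
    induction n with
    | zero => exact hu
    | succ n ih => rwa [pow_succ', mul_apply, apply_mem_support_of_mem_cycleFactorsFinset hc]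
  have hadj' : ∀ n, H.Adj ((σ ^ n) u) ((σ ^ (n + 1)) u) := by
    intro n
    rw [pow_succ', mul_apply]
    exact h.adj_apply (Equiv.Perm.mem_support.1 (mem_cycleFactorsFinset_support_le hc (hmem n)))
  have hadj : ∀ n, G.Adj ((σ ^ n) u) ((σ ^ (n + 1)) u) := fun n => (hadj' n).adj_sub
  have hinj : ∀ i j, i < m + 1 → j < m + 1 → (σ ^ i) u = (σ ^ j) u → i = j := by
    intro i j hi hj hij
    rw [hcyc.pow_apply_eq_pow_apply hu, hm] at hij
    exact Nat.ModEq.eq_of_lt_of_lt hij hi hj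
  have hlast : (σ ^ (m + 1)) u = u := by rw [← hm]; exact hcyc.pow_card_apply hu
  have hlastH : H.Adj ((σ ^ m) u) u := by have := hadj' m; rwa [hlast] at this
  let q : G.Walk u ((σ ^ m) u) := Walk.ofSeq (fun n => (σ ^ n) u) hadj m
  have hqs : q.support = (List.range (m + 1)).map fun n => (σ ^ n) u := Walk.support_ofSeq hadj m
  have hqe : q.edges = (List.range m).map fun n => s((σ ^ n) u, (σ ^ (n + 1)) u) :=
    Walk.edges_ofSeq hadj m
  have hqg : (Φ.walkGain q : ℂ) = _ := Φ.coe_walkGain_ofSeq hadj m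
  have hcycle : (q.cons hlastH.adj_sub).IsCycle := by
    rw [Walk.cons_isCycle_iff, Walk.isPath_def, hqs, hqe]
    constructor
    · refine List.Nodup.map_on ?_ List.nodup_range
      intro i hi j hj hij
      exact hinj i j (List.mem_range.1 hi) (List.mem_range.1 hj) hij
    · simp only [List.mem_map, List.mem_range, not_exists, not_and]
      intro i hi he
      rcases Sym2.eq_iff.1 he with ⟨h1, -⟩ | ⟨h1, h2⟩
      · have := hinj i m (by omega) (by omega) h1
        omega
      · have h1 := hinj i 0 (by omega) (by omega) (by simpa using h1)
        have h2 := hinj (i + 1) m (by omega) (by omega) h2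
        omega
  have hle : (q.cons hlastH.adj_sub).toSubgraph ≤ H := by
    rw [Walk.toSubgraph_le_iff (by simp)]
    intro e he
    rw [Walk.mem_edgeSet, Walk.edges_cons, hqe, List.mem_cons, List.mem_map] at he
    rcases he with rfl | ⟨n, -, rfl⟩
    · exact hlastH
    · exact hadj' n
  refine ⟨_, q.cons hlastH.adj_sub, hcycle, ?_, ?_⟩
  · rw [(h.toSubgraph_eq_induce hcycle hle).2, (eq_cycleOf_iff_mem_support hc).2 (hmem m)]
  · rw [Φ.coe_walkGain_cons, hqg]
    have : ∏ v ∈ c.support, Φ.pairGain v (σ v) =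
        ∏ i ∈ range (m + 1), Φ.pairGain ((σ ^ i) u) ((σ ^ (i + 1)) u) := by
      symm
      refine prod_nbij (fun i => (σ ^ i) u) (fun i _ => hmem i) ?_ ?_ ?_
      · intro i hi j hj hij
        exact hinj i j (by simpa using hi) (by simpa using hj) hij
      · intro v hv
        obtain ⟨n, hn, rfl⟩ := hcyc.exists_pow_eq hu hv
        exact ⟨n, by simpa [← hm] using hn, rfl⟩
      · intro i _
        rw [pow_succ', mul_apply]
    rw [this, prod_range_succ, hlast, mul_comm]

theorem cycles_eq_image (h : H.TraversedBy σ) [DecidableEq G.Subgraph] :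
    H.cycles = σ.longCycles.image fun c => H.induce (c.support : Set V) := by
  ext C
  rw [mem_cycles, mem_image]
  constructor
  · rintro ⟨hC, u, p, hp, rfl⟩
    obtain ⟨h1, h2⟩ := h.toSubgraph_eq_induce hp hC
    exact ⟨_, h1, h2.symm⟩
  · rintro ⟨c, hc, rfl⟩
    obtain ⟨u, p, hp, hpH, -⟩ := h.exists_isCycle hc ⟨fun _ => 1, fun _ => inv_one.symm⟩
    refine ⟨?_, u, p, hp, hpH⟩
    exact ⟨(coe_subset.2 (mem_cycleFactorsFinset_support_le (mem_longCycles.1 hc).1)).trans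
      h.support_subset, fun _ _ ha => ha.2.2⟩

theorem injOn_induce_support : Set.InjOn (fun c : Equiv.Perm V => H.induce (c.support : Set V))
    (σ.longCycles : Set (Equiv.Perm V)) := by
  intro c hc d hd hcd
  have hs : c.support = d.support := coe_injective (congrArg Subgraph.verts hcd)
  have hc := (mem_longCycles.1 hc).1
  have hd := (mem_longCycles.1 hd).1
  obtain ⟨u, hu⟩ := (mem_cycleFactorsFinset_iff.1 hc).1.nonempty_support
  rw [← (eq_cycleOf_iff_mem_support hc).2 hu, (eq_cycleOf_iff_mem_support hd).2 (hs ▸ hu)]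

theorem prod_cycleGainRe (h : H.TraversedBy σ) (Φ : G.GainGraph) :
    ∏ C ∈ H.cycles, Φ.cycleGainRe C =
      ∏ c ∈ σ.longCycles, (∏ v ∈ c.support, Φ.pairGain v (σ v)).re := by
  classical
  rw [h.cycles_eq_image, prod_image injOn_induce_support]
  refine prod_congr rfl fun c hc => ?_
  obtain ⟨u, p, hp, hpH, hg⟩ := h.exists_isCycle hc Φ
  rw [← hpH, Φ.cycleGainRe_toSubgraph hp, hg]

theorem oddCycles_eq (h : H.TraversedBy σ) :
    H.oddCycles = #{c ∈ σ.longCycles | Odd #c.support} := by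
  classical
  rw [oddCycles, h.cycles_eq_image, filter_image, card_image_of_injOn]
  · congr 1
    ext c
    simp [Set.ncard_coe_finset]
  · exact injOn_induce_support.mono (by intro c hc; exact (mem_filter.1 hc).1)

theorem neg_one_pow_card_support (h : H.TraversedBy σ) :
    (-1 : ℝ) ^ #σ.support = (-1) ^ H.oddCycles := by
  rw [h.oddCycles_eq, card_support_eq_sum_cycleFactorsFinset, ← prod_pow_eq_pow_sum, longCycles,
    filter_filter, ← prod_const, prod_filter]
  refine prod_congr rfl fun c hc => ?_
  have := two_le_card_support_of_mem_cycleFactorsFinset hc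
  split_ifs with h'
  · exact h'.2.neg_one_pow
  · refine Even.neg_one_pow ?_
    by_contra ho
    rw [Nat.not_even_iff_odd] at ho
    exact h' ⟨by obtain ⟨j, hj⟩ := ho; omega, ho⟩

end Subgraph.TraversedBy

end SimpleGraph

/-- The permutation obtained from `σ` by inverting the cycles which belong to `T`. -/
def Equiv.Perm.invertCycles {V : Type*} [Fintype V] [DecidableEq V] (σ : Equiv.Perm V)
    (T : Finset (Equiv.Perm V)) : Equiv.Perm V where
  toFun v := if σ.cycleOf v ∈ T then σ⁻¹ v else σ v
  invFun v := if σ.cycleOf v ∈ T then σ v else σ⁻¹ v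
  left_inv v := by
    have h1 : σ.cycleOf (σ v) = σ.cycleOf v :=
      (Equiv.Perm.sameCycle_apply_left.2 (.refl σ v)).cycleOf_eq
    have h2 : σ.cycleOf (σ⁻¹ v) = σ.cycleOf v :=
      (Equiv.Perm.sameCycle_apply_left.1 (by simpa using .refl σ v)).cycleOf_eq
    dsimp only
    split_ifs with h <;> simp_all
  right_inv v := by
    have h1 : σ.cycleOf (σ v) = σ.cycleOf v :=
      (Equiv.Perm.sameCycle_apply_left.2 (.refl σ v)).cycleOf_eq
    have h2 : σ.cycleOf (σ⁻¹ v) = σ.cycleOf v :=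
      (Equiv.Perm.sameCycle_apply_left.1 (by simpa using .refl σ v)).cycleOf_eq
    dsimp only
    split_ifs with h <;> simp_all

theorem Equiv.Perm.invertCycles_apply {V : Type*} [Fintype V] [DecidableEq V] (σ : Equiv.Perm V)
    (T : Finset (Equiv.Perm V)) (v : V) :
    σ.invertCycles T v = if σ.cycleOf v ∈ T then σ⁻¹ v else σ v := rfl

namespace SimpleGraph

open Finset Equiv.Perm

variable {V : Type*} {G : SimpleGraph V} {H : G.Subgraph} {σ : Equiv.Perm V}
  [Fintype V] [DecidableEq V]

theorem GainGraph.prod_pairGain_inv (Φ : G.GainGraph) {c : Equiv.Perm V}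
    (hc : c ∈ σ.cycleFactorsFinset) :
    ∏ v ∈ c.support, Φ.pairGain v (σ⁻¹ v) = (∏ v ∈ c.support, Φ.pairGain v (σ v))⁻¹ := by
  rw [← prod_inv_distrib]
  symm
  refine prod_equiv σ (fun v => (apply_mem_support_of_mem_cycleFactorsFinset hc).symm) fun v _ => ?_
  have : σ⁻¹ (σ v) = v := by simp
  rw [this, Φ.pairGain_symm v]

theorem GainGraph.prod_pairGain_of_card_eq_two (Φ : G.GainGraph) {c : Equiv.Perm V}
    (hc : c ∈ σ.cycleFactorsFinset) (h2 : #c.support = 2) :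
    ∏ v ∈ c.support, Φ.pairGain v (σ v) = 1 := by
  obtain ⟨u, hu⟩ := (mem_cycleFactorsFinset_iff.1 hc).1.nonempty_support
  have hs : c.support = {u, σ u} := by
    symm
    refine eq_of_subset_of_card_le ?_ ?_
    · simp only [insert_subset_iff, singleton_subset_iff]
      exact ⟨hu, (apply_mem_support_of_mem_cycleFactorsFinset hc).2 hu⟩
    · rw [h2, card_pair]
      exact (Equiv.Perm.mem_support.1 (mem_cycleFactorsFinset_support_le hc hu)).symm
  rw [hs, prod_pair (Equiv.Perm.mem_support.1 (mem_cycleFactorsFinset_support_le hc hu)).symm,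
    (apply_apply_eq_self_iff_card_support hc hu).2 h2, Φ.pairGain_symm u, mul_inv_cancel₀]
  rw [← norm_ne_zero_iff, Φ.norm_pairGain]
  exact one_ne_zero

namespace Subgraph.TraversedBy

theorem traversedBy_invertCycles (h : H.TraversedBy σ) (T : Finset (Equiv.Perm V)) :
    H.TraversedBy (σ.invertCycles T) := by
  have key : ∀ v w, σ.invertCycles T v = w → σ v = w ∨ σ w = v := by
    rintro v w rfl
    rw [invertCycles_apply]
    split_ifs
    · exact Or.inr (by simp)
    · exact Or.inl rfl
  have key' : ∀ v w, σ v = w → σ.invertCycles T v = w ∨ σ.invertCycles T w = v := by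
    rintro v w rfl
    have h1 : σ.cycleOf (σ v) = σ.cycleOf v := (sameCycle_apply_left.2 (.refl σ v)).cycleOf_eq
    rw [invertCycles_apply, invertCycles_apply, h1]
    split_ifs
    · exact Or.inr (by simp)
    · exact Or.inl rfl
  intro v w
  rw [h]
  refine and_congr_right fun _ => ⟨?_, ?_⟩
  · rintro (h | h)
    · exact key' _ _ h
    · exact (key' _ _ h).symm
  · rintro (h | h)
    · exact key _ _ h
    · exact (key _ _ h).symm

theorem eq_or_eq_inv {τ : Equiv.Perm V} (h : H.TraversedBy σ) (hτ : H.TraversedBy τ) (v : V) :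
    τ v = σ v ∨ τ v = σ⁻¹ v := by
  by_cases hv : τ v = v
  · have : v ∉ σ.support := by
      rw [← h.degree_ne_zero_iff, hτ.degree_ne_zero_iff]
      simpa using hv
    left
    rw [hv, notMem_support.1 this]
  · rcases ((h _ _).1 (hτ.adj_apply hv)).2 with h | h
    · exact Or.inl h.symm
    · exact Or.inr (eq_inv_iff_eq.2 h)

theorem apply_eq_apply_of_sameCycle {τ : Equiv.Perm V} (h : H.TraversedBy σ)
    (hτ : H.TraversedBy τ) {v w : V} (hvw : σ.SameCycle v w) (hv : τ v = σ v) : τ w = σ w := by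
  refine hvw.closed_of_apply (p := fun v => τ v = σ v) (fun x hx => ?_) hv
  rcases h.eq_or_eq_inv hτ (σ x) with h1 | h1
  · exact h1
  · have hi : σ⁻¹ (σ x) = x := by simp
    rw [hi] at h1
    by_contra hne
    by_cases hs : σ (σ x) = σ x
    · have hsx := σ.injective hs
      exact hne (by rw [hsx, hx])
    · rcases ((hτ _ _).1 (h.adj_apply hs)).2 with h2 | h2
      · exact hne h2
      · exact hne (h1.trans (τ.injective (h2.trans hx.symm)).symm)

theorem exists_eq_invertCycles {τ : Equiv.Perm V} (h : H.TraversedBy σ) (hτ : H.TraversedBy τ) :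
    ∃ T ⊆ σ.longCycles, σ.invertCycles T = τ := by
  classical
  refine ⟨σ.longCycles.filter fun c => ∃ v ∈ c.support, τ v ≠ σ v, filter_subset _ _, ?_⟩
  ext v
  rw [invertCycles_apply]
  split_ifs with hT
  · rw [mem_filter] at hT
    obtain ⟨hc, w, hw, hne⟩ := hT
    have hvw : σ.SameCycle v w := (mem_support_cycleOf_iff.1 hw).1
    rcases h.eq_or_eq_inv hτ v with h1 | h1
    · exact absurd (h.apply_eq_apply_of_sameCycle hτ hvw h1) hne
    · exact h1.symm
  · rcases h.eq_or_eq_inv hτ v with h1 | h1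
    · exact h1.symm
    · by_contra hne
      have hv : σ v ≠ v := by
        intro hv
        rw [h1, inv_eq_iff_eq.2 hv.symm, hv] at hne
        exact hne rfl
      have hc : σ.cycleOf v ∈ σ.cycleFactorsFinset :=
        cycleOf_mem_cycleFactorsFinset_iff.2 (Equiv.Perm.mem_support.2 hv)
      have hvc := (eq_cycleOf_iff_mem_support hc).1 rfl
      refine hT (mem_filter.2 ⟨mem_longCycles.2 ⟨hc, ?_⟩, v, hvc, fun h => hne h.symm⟩)
      refine lt_of_le_of_ne (two_le_card_support_of_mem_cycleFactorsFinset hc) fun h2 => hne ?_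
      rw [h1, eq_inv_iff_eq]
      exact (apply_apply_eq_self_iff_card_support hc hvc).2 h2.symm

theorem injOn_invertCycles (σ : Equiv.Perm V) :
    Set.InjOn σ.invertCycles (σ.longCycles.powerset : Set (Finset (Equiv.Perm V))) := by
  have key : ∀ T T' : Finset (Equiv.Perm V), T ⊆ σ.longCycles →
      σ.invertCycles T = σ.invertCycles T' → T ⊆ T' := by
    intro T T' hT hTT' c hcT
    obtain ⟨hc, h3⟩ := mem_longCycles.1 (hT hcT)
    obtain ⟨u, hu⟩ := (mem_cycleFactorsFinset_iff.1 hc).1.nonempty_support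
    have hcu := (eq_cycleOf_iff_mem_support hc).2 hu
    have := congrArg (· u) hTT'
    simp only [invertCycles_apply, hcu, hcT, if_true] at this
    by_contra hn
    rw [if_neg hn, inv_eq_iff_eq, eq_comm, apply_apply_eq_self_iff_card_support hc hu] at this
    omega
  intro T hT T' hT' hTT'
  exact Subset.antisymm (key _ _ (mem_powerset.1 hT) hTT') (key _ _ (mem_powerset.1 hT') hTT'.symm)

theorem prod_pairGain_invertCycles (h : H.TraversedBy σ) (Φ : G.GainGraph)
    {T : Finset (Equiv.Perm V)} (hT : T ⊆ σ.longCycles) :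
    ∏ v ∈ (σ.invertCycles T).support, Φ.pairGain v (σ.invertCycles T v) =
      (∏ c ∈ T, (∏ v ∈ c.support, Φ.pairGain v (σ v))⁻¹) *
        ∏ c ∈ σ.longCycles \ T, ∏ v ∈ c.support, Φ.pairGain v (σ v) := by
  have hs : (σ.invertCycles T).support = σ.support := by
    ext v
    rw [← h.degree_ne_zero_iff, (h.traversedBy_invertCycles T).degree_ne_zero_iff]
  rw [hs, prod_support_eq_prod_cycleFactorsFinset,
    ← prod_filter_mul_prod_filter_not _ (fun c : Equiv.Perm V => 2 < #c.support),
    prod_eq_one (s := filter (fun c : Equiv.Perm V => ¬ 2 < #c.support) _), mul_one]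
  · change ∏ c ∈ σ.longCycles, _ = _
    rw [← prod_sdiff hT, mul_comm]
    congr 1
    · refine prod_congr rfl fun c hc => ?_
      have hc' := (mem_longCycles.1 (hT hc)).1
      rw [← Φ.prod_pairGain_inv hc']
      refine prod_congr rfl fun v hv => ?_
      rw [invertCycles_apply, if_pos ((eq_cycleOf_iff_mem_support hc').2 hv ▸ hc)]
    · refine prod_congr rfl fun c hc => prod_congr rfl fun v hv => ?_
      rw [mem_sdiff] at hc
      rw [invertCycles_apply, (eq_cycleOf_iff_mem_support (mem_longCycles.1 hc.1).1).2 hv,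
        if_neg hc.2]
  · intro c hc
    obtain ⟨hc, h2⟩ := mem_filter.1 hc
    have h2' : #c.support = 2 := by
      have := two_le_card_support_of_mem_cycleFactorsFinset hc
      omega
    rw [← Φ.prod_pairGain_of_card_eq_two hc h2']
    refine prod_congr rfl fun v hv => ?_
    rw [invertCycles_apply, (eq_cycleOf_iff_mem_support hc).2 hv, if_neg]
    exact fun hcT => h2 (mem_longCycles.1 (hT hcT)).2

open Classical in
/-- The gains of all permutations traversing `H` sum up to a product over the cycles of `H`. -/
theorem sum_prod_pairGain (h : H.TraversedBy σ) (Φ : G.GainGraph) :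
    ∑ τ : Equiv.Perm V with H.TraversedBy τ, ∏ v ∈ τ.support, Φ.pairGain v (τ v) =
      (((2 : ℝ) ^ H.corank * ∏ C ∈ H.cycles, Φ.cycleGainRe C : ℝ) : ℂ) := by
  have h1 : (((2 : ℝ) ^ H.corank * ∏ C ∈ H.cycles, Φ.cycleGainRe C : ℝ) : ℂ) =
      ∏ c ∈ σ.longCycles, ((∏ v ∈ c.support, Φ.pairGain v (σ v))⁻¹ +
        ∏ v ∈ c.support, Φ.pairGain v (σ v)) := by
    rw [h.prod_cycleGainRe, h.corank_eq, zpow_natCast, ← prod_const, ← prod_mul_distrib,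
      Complex.ofReal_prod]
    refine prod_congr rfl fun c _ => ?_
    have hn : ‖∏ v ∈ c.support, Φ.pairGain v (σ v)‖ = 1 := by
      rw [norm_prod]
      exact prod_eq_one fun v _ => Φ.norm_pairGain _ _
    rw [Complex.inv_def, Complex.normSq_eq_norm_sq, hn, add_comm, one_pow, inv_one,
      Complex.ofReal_one, mul_one, Complex.add_conj, Complex.ofReal_mul]
  rw [h1, prod_add]
  symm
  refine sum_nbij σ.invertCycles (fun T _ => ?_) (injOn_invertCycles σ) ?_ fun T hT => ?_
  · exact mem_filter.2 ⟨mem_univ _, h.traversedBy_invertCycles T⟩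
  · intro τ hτ
    obtain ⟨T, hT, rfl⟩ := h.exists_eq_invertCycles (mem_filter.1 hτ).2
    exact ⟨T, mem_powerset.2 hT, rfl⟩
  · exact (h.prod_pairGain_invertCycles Φ (mem_powerset.1 hT)).symm

end Subgraph.TraversedBy

end SimpleGraph

namespace SimpleGraph

open Finset Equiv.Perm

/-- A graph whose edges are the pairs `{a, σ a}` for a permutation `σ` with a single orbit is
a cycle graph. -/
theorem nonempty_iso_cycleGraph {V α : Type*} {σ : Equiv.Perm V} {s : Finset V}
    (hσ : σ.IsCycleOn (s : Set V)) (hs : s.Nonempty) {Γ : SimpleGraph α} (e : α ≃ s)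
    (hΓ : ∀ a b, Γ.Adj a b ↔ a ≠ b ∧ (σ (e a) = e b ∨ σ (e b) = e a)) :
    Nonempty (Γ ≃g cycleGraph #s) := by
  obtain ⟨u, hu⟩ := hs
  have hmem : ∀ n, (σ ^ n) u ∈ s := by
    intro n
    induction n with
    | zero => exact hu
    | succ n ih => rw [pow_succ', mul_apply]; exact hσ.apply_mem_iff.2 ih
  obtain ⟨n, hn⟩ : ∃ n, #s = n + 1 := ⟨#s - 1, by have := card_pos.2 ⟨u, hu⟩; omega⟩
  have hinj : ∀ i j, (σ ^ i) u = (σ ^ j) u ↔ i ≡ j [MOD n + 1] := fun i j => by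
    rw [hσ.pow_apply_eq_pow_apply hu, hn]
  rw [hn]
  let f : Fin (n + 1) → α := fun i => e.symm ⟨(σ ^ (i : ℕ)) u, hmem i⟩
  have hf : Function.Bijective f := by
    constructor
    · intro i j hij
      have := congrArg Subtype.val (e.symm.injective hij)
      exact Fin.ext (Nat.ModEq.eq_of_lt_of_lt ((hinj i j).1 this) i.2 j.2)
    · intro a
      obtain ⟨i, hi, hia⟩ := hσ.exists_pow_eq hu (e a).2
      exact ⟨⟨i, hn ▸ hi⟩, by rw [Equiv.symm_apply_eq]; exact Subtype.ext hia⟩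
  refine ⟨(RelIso.mk (Equiv.ofBijective f hf) ?_ : cycleGraph (n + 1) ≃g Γ).symm⟩
  intro i j
  have hstep : ∀ i j : Fin (n + 1), σ ((σ ^ (i : ℕ)) u) = (σ ^ (j : ℕ)) u ↔ j = i + 1 := by
    intro i j
    rw [← mul_apply, ← pow_succ', hinj, Fin.ext_iff, Fin.val_add, Nat.ModEq,
      Nat.mod_eq_of_lt j.2, Fin.val_one', Nat.add_mod_mod, eq_comm]
  rw [Equiv.ofBijective_apply, Equiv.ofBijective_apply, hΓ, hf.injective.ne_iff]
  simp only [f, Equiv.apply_symm_apply, hstep]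
  obtain _ | m := n
  · obtain rfl : i = j := Fin.ext (by omega)
    simp
  · rw [cycleGraph_adj, sub_eq_iff_eq_add', sub_eq_iff_eq_add', or_comm, and_iff_right_of_imp]
    rintro (rfl | rfl) <;> simp

/-- Every cycle graph is given by a permutation. -/
theorem exists_perm_cycleGraph (n : ℕ) : ∃ τ : Equiv.Perm (Fin n), ∀ i j,
    (cycleGraph n).Adj i j ↔ i ≠ j ∧ (τ i = j ∨ τ j = i) := by
  obtain _ | _ | m := n
  · exact ⟨1, fun i => i.elim0⟩
  · refine ⟨1, fun i j => ?_⟩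
    obtain rfl : i = j := Fin.ext (by omega)
    simp
  · refine ⟨Equiv.addRight 1, fun i j => ?_⟩
    rw [cycleGraph_adj, Equiv.coe_addRight, sub_eq_iff_eq_add', sub_eq_iff_eq_add', or_comm,
      eq_comm (a := i) (b := j + 1), eq_comm (a := j) (b := i + 1), and_iff_right_of_imp]
    rintro (rfl | rfl) <;> simp

namespace Subgraph

variable {V : Type*} {G : SimpleGraph V} {H : G.Subgraph}

theorem isDissection_iff_cycleGraph : H.IsDissection ↔
    ∀ c : H.coe.ConnectedComponent, ∃ n : ℕ, 1 ≤ n ∧ Nonempty (c.toSimpleGraph ≃g cycleGraph n) := by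
  refine forall_congr' fun c => ⟨?_, ?_⟩
  · rintro (h | h | ⟨n, hn, h⟩)
    · exact ⟨1, le_rfl, by rwa [cycleGraph_one_eq_top]⟩
    · exact ⟨2, by norm_num, by rwa [cycleGraph_two_eq_top]⟩
    · exact ⟨n, by omega, h⟩
  · rintro ⟨n, hn, h⟩
    obtain rfl | rfl | h3 : n = 1 ∨ n = 2 ∨ 3 ≤ n := by omega
    · left; rwa [cycleGraph_one_eq_top] at h
    · right; left; rwa [cycleGraph_two_eq_top] at h
    · exact Or.inr (Or.inr ⟨n, h3, h⟩)

theorem IsDissection.exists_traversedBy (hH : H.IsDissection) :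
    ∃ σ : Equiv.Perm V, H.TraversedBy σ := by
  classical
  rw [isDissection_iff_cycleGraph] at hH
  have h1 : ∀ c : H.coe.ConnectedComponent, ∃ τ : Equiv.Perm c.supp, ∀ a b,
      c.toSimpleGraph.Adj a b ↔ a ≠ b ∧ (τ a = b ∨ τ b = a) := by
    intro c
    obtain ⟨n, -, ⟨e⟩⟩ := hH c
    obtain ⟨τ, hτ⟩ := exists_perm_cycleGraph n
    refine ⟨(e.toEquiv.trans τ).trans e.toEquiv.symm, fun a b => ?_⟩
    rw [← e.map_adj_iff, hτ, e.injective.ne_iff]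
    simp [Equiv.symm_apply_eq]
  choose τ hτ using h1
  let e : H.verts ≃ Σ c : H.coe.ConnectedComponent, c.supp :=
    (Equiv.sigmaFiberEquiv H.coe.connectedComponentMk).symm
  let ρ : Equiv.Perm H.verts := (e.trans (Equiv.sigmaCongrRight τ)).trans e.symm
  have hρ : ∀ (v : H.verts) (c) (hv : H.coe.connectedComponentMk v = c),
      ρ v = (τ c ⟨v, hv⟩ : H.verts) := by
    rintro v _ rfl
    rfl
  have hadj : ∀ v w : H.verts, H.Adj v w ↔ v ≠ w ∧ (ρ v = w ∨ ρ w = v) := by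
    intro v w
    have hc : ∀ v w : H.verts, ρ v = w →
        H.coe.connectedComponentMk w = H.coe.connectedComponentMk v := by
      rintro v w rfl
      rw [hρ v _ rfl]
      exact (τ (H.coe.connectedComponentMk v) ⟨v, rfl⟩).2
    have key : H.coe.connectedComponentMk w = H.coe.connectedComponentMk v →
        (H.Adj v w ↔ v ≠ w ∧ (ρ v = w ∨ ρ w = v)) := by
      intro hvw
      have h := hτ (H.coe.connectedComponentMk v) ⟨v, rfl⟩ ⟨w, hvw⟩
      rw [hρ v _ rfl, hρ w _ hvw]
      simpa [Subtype.ext_iff, ConnectedComponent.toSimpleGraph] using h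
    refine ⟨fun h => (key ?_).1 h, fun h => (key ?_).2 h⟩
    · exact ConnectedComponent.sound (Adj.reachable (G := H.coe) h).symm
    · rcases h.2 with h | h
      · exact hc _ _ h
      · exact (hc _ _ h).symm
  refine ⟨Equiv.Perm.ofSubtype ρ, fun v w => ?_⟩
  by_cases hv : v ∈ H.verts
  · by_cases hw : w ∈ H.verts
    · rw [ofSubtype_apply_of_mem ρ hv, ofSubtype_apply_of_mem ρ hw, hadj ⟨v, hv⟩ ⟨w, hw⟩]
      simp [Subtype.ext_iff]
    · rw [ofSubtype_apply_of_mem ρ hv, ofSubtype_apply_of_not_mem ρ hw]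
      refine iff_of_false (fun h => hw h.snd_mem) ?_
      rintro ⟨h1, h | h⟩
      · exact hw (h ▸ Subtype.prop _)
      · exact h1 h.symm
  · refine iff_of_false (fun h => hv h.fst_mem) ?_
    rw [ofSubtype_apply_of_not_mem ρ hv]
    rintro ⟨h1, h | h⟩
    · exact h1 h
    · by_cases hw : w ∈ H.verts
      · rw [ofSubtype_apply_of_mem ρ hw] at h
        exact hv (h ▸ Subtype.prop _)
      · rw [ofSubtype_apply_of_not_mem ρ hw] at h
        exact h1 h.symm

theorem TraversedBy.isDissection [Fintype V] [DecidableEq V] {σ : Equiv.Perm V}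
    (h : H.TraversedBy σ) : H.IsDissection := by
  classical
  rw [isDissection_iff_cycleGraph]
  intro c
  obtain ⟨v, rfl⟩ := c.exists_rep
  set c : H.coe.ConnectedComponent := H.coe.connectedComponentMk v with hc
  have hmem : ∀ w : H.verts, w ∈ c.supp ↔ σ.SameCycle v w := fun w => by
    rw [ConnectedComponent.mem_supp_iff, hc, ConnectedComponent.eq, h.reachable_iff, sameCycle_comm]
  let s : Finset V := univ.filter fun w => σ.SameCycle v w
  have hs : ∀ w, w ∈ s ↔ σ.SameCycle v w := fun w => by simp [s]
  have hcyc : σ.IsCycleOn (s : Set V) := by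
    refine ⟨⟨fun w hw => ?_, σ.injective.injOn, fun w hw => ⟨σ⁻¹ w, ?_, by simp⟩⟩,
      fun x hx y hy => ((hs x).1 hx).symm.trans ((hs y).1 hy)⟩
    · exact (hs _).2 (sameCycle_apply_right.2 ((hs w).1 hw))
    · exact (hs _).2 (sameCycle_apply_right.1 (by simpa using (hs w).1 hw))
  have hsv : ∀ w, σ.SameCycle v w → w ∈ H.verts := fun w hw =>
    hw.closed_of_apply (p := (· ∈ H.verts)) (fun x hx => h.apply_mem_verts hx) v.2
  let e : c.supp ≃ s :=
    { toFun := fun w => ⟨w.1.1, (hs _).2 ((hmem _).1 w.2)⟩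
      invFun := fun w => ⟨⟨w.1, hsv _ ((hs _).1 w.2)⟩, (hmem _).2 ((hs _).1 w.2)⟩
      left_inv := fun _ => rfl
      right_inv := fun _ => rfl }
  have hne : s.Nonempty := ⟨v, (hs _).2 (.refl σ _)⟩
  refine ⟨#s, card_pos.2 hne, nonempty_iso_cycleGraph hcyc hne e fun a b => ?_⟩
  refine (h a.1.1 b.1.1).trans ?_
  rw [Ne, Ne, Subtype.ext_iff, Subtype.ext_iff]
  rfl

end Subgraph

end SimpleGraph

namespace SimpleGraph

open Finset Equiv.Perm

variable {V : Type*} [Fintype V] [DecidableEq V] {G : SimpleGraph V}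

namespace GainGraph

theorem normalizedLaplacian_self [DecidableRel G.Adj] (Φ : G.GainGraph) {v : V}
    (hv : G.degree v ≠ 0) : Φ.normalizedLaplacian v v = 1 := by
  simp [normalizedLaplacian, hv]

theorem normalizedLaplacian_of_adj [DecidableRel G.Adj] (Φ : G.GainGraph) {v w : V}
    (hvw : G.Adj v w) : Φ.normalizedLaplacian v w =
      -Φ.pairGain v w / (Real.sqrt ((G.degree v : ℝ) * (G.degree w : ℝ)) : ℂ) := by
  simp [normalizedLaplacian, hvw, hvw.ne, pairGain]

theorem normalizedLaplacian_of_not_adj [DecidableRel G.Adj] (Φ : G.GainGraph) {v w : V}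
    (hne : v ≠ w) (hvw : ¬ G.Adj v w) : Φ.normalizedLaplacian v w = 0 := by
  simp [normalizedLaplacian, hne, hvw]

end GainGraph

namespace Subgraph.TraversedBy

variable {H : G.Subgraph} {σ : Equiv.Perm V}

theorem sign_mul_prod_normalizedLaplacian [DecidableRel G.Adj] (h : H.TraversedBy σ)
    (Φ : G.GainGraph) (hG : ∀ v : V, G.degree v ≠ 0) {S : Finset V} (hS : σ.support ⊆ S) :
    ((σ.sign : ℤ) : ℂ) * ∏ v ∈ S, Φ.normalizedLaplacian v (σ v) =
      (((-1 : ℝ) ^ (H.rank + (H.oddCycles : ℤ)) / (H.degreeProd : ℝ) : ℝ) : ℂ) *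
        ∏ v ∈ σ.support, Φ.pairGain v (σ v) := by
  have h1 : ∏ v ∈ S, Φ.normalizedLaplacian v (σ v) =
      ∏ v ∈ σ.support, Φ.normalizedLaplacian v (σ v) := by
    refine (prod_subset hS fun v _ hv => ?_).symm
    rw [notMem_support.1 hv, Φ.normalizedLaplacian_self (hG v)]
  have h2 : ∏ v ∈ σ.support, Φ.normalizedLaplacian v (σ v) =
      ∏ v ∈ σ.support, -Φ.pairGain v (σ v) /
        (Real.sqrt ((G.degree v : ℝ) * (G.degree (σ v) : ℝ)) : ℂ) :=
    prod_congr rfl fun v hv =>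
      Φ.normalizedLaplacian_of_adj (h.adj_apply (Equiv.Perm.mem_support.1 hv)).adj_sub
  have h3 : ∏ v ∈ σ.support, Real.sqrt ((G.degree v : ℝ) * (G.degree (σ v) : ℝ)) =
      (H.degreeProd : ℝ) := by
    simp_rw [Real.sqrt_mul (Nat.cast_nonneg _)]
    rw [prod_mul_distrib, σ.prod_support_apply fun v => Real.sqrt (G.degree v : ℝ),
      ← prod_mul_distrib, h.degreeProd_eq, Nat.cast_prod]
    refine prod_congr rfl fun v _ => ?_
    rw [Real.mul_self_sqrt (Nat.cast_nonneg _)]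
    congr!
  rw [h1, h2, prod_div_distrib, ← Complex.ofReal_prod, h3, prod_neg,
    zpow_add₀ (by norm_num), h.neg_one_zpow_rank, zpow_natCast, ← h.neg_one_pow_card_support]
  push_cast
  ring

end Subgraph.TraversedBy

/-- The subgraph with vertex set `S` whose edges join the vertices not fixed by `σ` to their
images. -/
def Subgraph.ofPerm (σ : Equiv.Perm V) (hσ : ∀ v, σ v ≠ v → G.Adj v (σ v)) (S : Finset V)
    (hS : σ.support ⊆ S) : G.Subgraph where
  verts := S
  Adj v w := v ≠ w ∧ (σ v = w ∨ σ w = v)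
  adj_sub := by
    rintro v w ⟨hne, rfl | rfl⟩
    · exact hσ v hne.symm
    · exact (hσ w hne).symm
  edge_vert := by
    rintro v w ⟨hne, rfl | rfl⟩
    · exact hS (Equiv.Perm.mem_support.2 hne.symm)
    · exact hS (Equiv.Perm.mem_support.2 fun h => hne (σ.injective h))
  symm := ⟨fun _ _ h => ⟨h.1.symm, h.2.symm⟩⟩

omit [DecidableEq V] in
theorem Subgraph.mem_dissections {H : G.Subgraph} {k : ℕ} :
    H ∈ dissections G k ↔ H.IsDissection ∧ H.verts.ncard = k := by
  simp [dissections]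

open Classical in
theorem GainGraph.sum_prod_normalizedLaplacian [DecidableRel G.Adj] (Φ : G.GainGraph)
    (σ : Equiv.Perm V) (k : ℕ) :
    ∑ S ∈ powersetCard k univ with σ.support ⊆ S, ∏ v ∈ S, Φ.normalizedLaplacian v (σ v) =
      ∑ H ∈ Subgraph.dissections G k with H.TraversedBy σ,
        ∏ v ∈ H.verts.toFinset, Φ.normalizedLaplacian v (σ v) := by
  by_cases hσ : ∀ v, σ v ≠ v → G.Adj v (σ v)
  · symm
    refine sum_nbij (fun H => H.verts.toFinset) (fun H hH => ?_) ?_ ?_ fun _ _ => rfl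
    · obtain ⟨hd, ht⟩ := mem_filter.1 hH
      rw [mem_filter, mem_powersetCard, ← Set.ncard_eq_toFinset_card']
      refine ⟨⟨subset_univ _, (Subgraph.mem_dissections.1 hd).2⟩, ?_⟩
      rw [← coe_subset, Set.coe_toFinset]
      exact ht.support_subset
    · intro H hH H' hH' hHH'
      have ht := (mem_filter.1 hH).2
      have ht' := (mem_filter.1 hH').2
      refine Subgraph.ext (Set.toFinset_inj.1 hHH') ?_
      ext v w
      rw [ht, ht']
    · intro S hS
      obtain ⟨hS, hsub⟩ := mem_filter.1 hS
      have ht : (Subgraph.ofPerm σ hσ S hsub).TraversedBy σ := fun v w => Iff.rfl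
      refine ⟨Subgraph.ofPerm σ hσ S hsub,
        mem_filter.2 ⟨Subgraph.mem_dissections.2 ⟨ht.isDissection, ?_⟩, ht⟩, ?_⟩
      · exact (Set.ncard_coe_finset S).trans (mem_powersetCard.1 hS).2
      · exact Finset.coe_injective (Set.coe_toFinset _)
  · rw [sum_eq_zero, sum_eq_zero]
    · intro H hH
      exact absurd (fun v hv => ((mem_filter.1 hH).2.adj_apply hv).adj_sub) hσ
    · intro S hS
      push Not at hσ
      obtain ⟨v, hv, hadj⟩ := hσ
      exact prod_eq_zero ((mem_filter.1 hS).2 (Equiv.Perm.mem_support.2 hv))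
        (Φ.normalizedLaplacian_of_not_adj hv.symm hadj)

open Classical in
/-- The contribution of a dissection subgraph to the characteristic polynomial. -/
theorem GainGraph.sum_sign_mul_prod_normalizedLaplacian [DecidableRel G.Adj] (Φ : G.GainGraph)
    (hG : ∀ v : V, G.degree v ≠ 0) {H : G.Subgraph} (hH : H.IsDissection) :
    ∑ σ : Equiv.Perm V with H.TraversedBy σ,
        ((σ.sign : ℤ) : ℂ) * ∏ v ∈ H.verts.toFinset, Φ.normalizedLaplacian v (σ v) =
      (((-1 : ℝ) ^ (H.rank + (H.oddCycles : ℤ)) * ((2 : ℝ) ^ H.corank / (H.degreeProd : ℝ)) *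
        ∏ C ∈ H.cycles, Φ.cycleGainRe C : ℝ) : ℂ) := by
  obtain ⟨σ, hσ⟩ := hH.exists_traversedBy
  have h1 : ∀ τ ∈ (univ : Finset (Equiv.Perm V)).filter (H.TraversedBy ·),
      ((τ.sign : ℤ) : ℂ) * ∏ v ∈ H.verts.toFinset, Φ.normalizedLaplacian v (τ v) =
        (((-1 : ℝ) ^ (H.rank + (H.oddCycles : ℤ)) / (H.degreeProd : ℝ) : ℝ) : ℂ) *
          ∏ v ∈ τ.support, Φ.pairGain v (τ v) := by
    intro τ hτ
    have hτ := (mem_filter.1 hτ).2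
    refine hτ.sign_mul_prod_normalizedLaplacian Φ hG ?_
    rw [← coe_subset, Set.coe_toFinset]
    exact hτ.support_subset
  rw [sum_congr rfl h1, ← mul_sum, hσ.sum_prod_pairGain Φ, ← Complex.ofReal_mul]
  congr 1
  ring

end SimpleGraph

theorem mainTheorem10 {V : Type*} [Fintype V] [DecidableEq V] (G : SimpleGraph V)
    [DecidableRel G.Adj] (Φ : G.GainGraph) (hG : ∀ v : V, G.degree v ≠ 0)
    (k : ℕ) (hk1 : 1 ≤ k) (hkn : k ≤ Fintype.card V) :
    (-1 : ℂ) ^ k * Φ.normalizedLaplacian.charpoly.coeff (Fintype.card V - k) =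
      ((∑ H ∈ SimpleGraph.Subgraph.dissections G k,
        (-1 : ℝ) ^ (H.rank + (H.oddCycles : ℤ)) * ((2 : ℝ) ^ H.corank / (H.degreeProd : ℝ)) *
          ∏ C ∈ H.cycles, Φ.cycleGainRe C : ℝ) : ℂ) := by
  classical
  rw [Matrix.neg_one_pow_mul_charpoly_coeff _ hkn, Complex.ofReal_sum]
  simp_rw [← Finset.mul_sum, Φ.sum_prod_normalizedLaplacian, Finset.mul_sum]
  rw [Finset.sum_comm' (t' := SimpleGraph.Subgraph.dissections G k)
    (s' := fun H => {σ : Equiv.Perm V | H.TraversedBy σ}) (by simp [and_comm])]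
  refine Finset.sum_congr rfl fun H hH => ?_
  exact Φ.sum_sign_mul_prod_normalizedLaplacian hG (SimpleGraph.Subgraph.mem_dissections.1 hH).1
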